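/- Let $\mathbf{Mon}$ be the category of monoids and monoid homomorphisms, and let $\mathrm{Span}(\mathbf{Mon})$ be the bicategory whose objects are monoids, whose 1-cells $x\to y$ are spans $x\leftarrow z\to y$ of homomorphisms, composed by pullback, and whose 2-cells are morphisms of spans. A monad on an object $x$ of a bicategory is a 1-cell $t:x\to x$ with 2-cells $\eta:\mathrm{id}_x\to t$ and $\mu:t;t\to t$ satisfying the unit and associativity laws. Let $\mathrm{Mod}(\mathrm{Span}(\mathbf{Mon}))$ be the bicategory whose objects are the monads in $\mathrm{Span}(\mathbf{Mon})$, whose 1-cells $F\to G$ are the $F$-$G$-bimodules (1-cells $H$ with compatible actions $F;H\to H$ and $H;G\to H$ satisfying the unit and associativity laws), and whose 2-cells are bimodule morphisms; the identity 1-cell on $F$ is $F$ with both actions given by its multiplication, and the composite $H\otimes_D H'$ of bimodules is the coequaliser of the two 2-cells $H;D;H'\rightrightarrows H;H'$ given by the actions of $D$ on $H$ and on $H'$. A PROP is a symmetric strict monoidal category whose objects are the natural numbers and whose monoidal product $\oplus$ is addition on objects. Any PROP $T$ gives a monad in $\mathrm{Span}(\mathbf{Mon})$ on $(\mathbb N,+,0)$,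 with underlying span $\mathbb N\leftarrow \mathrm{Ar}(T)\to\mathbb N$ (the source and target maps on the monoid of arrows under $\oplus$), the unit given by identities and the multiplication by composition. The core $J$ of $T$ is the sub-PROP of $T$ whose arrows are the isomorphisms of $T$; it is regarded in this way as an object of $\mathrm{Mod}(\mathrm{Span}(\mathbf{Mon}))$. Below, $f;g$ denotes composition in diagrammatic order. **Lemma.** Let $T$ be a PROP with core $J$. Then both $T$ and $T^{\mathrm{op}}$ are monads on $J$ in $\mathrm{Mod}(\mathrm{Span}(\mathbf{Mon}))$. More precisely: 1. The span $\mathbb N\leftarrow\mathrm{Ar}(T)\to\mathbb N$ carries a $J$-$J$-bimodule structure whose actions are composition in $T$, $(j,f)\mapsto j;f$ and $(f,j)\mapsto f;j$, and this bimodule $J\to J$ carries a monad structure in $\mathrm{Mod}(\mathrm{Span}(\mathbf{Mon}))$ whose unit $J\to T$ is the inclusion $j\mapsto j$ and whose multiplication $T\otimes_J T\to T$ is composition in $T$, $[f,g]\mapsto f;g$. 2. The span $\mathbb N\leftarrow\mathrm{Ar}(T^{\mathrm{op}})\to\mathbb N$ carries a $J$-$J$-bimodule structure whose actions are composition in $T^{\mathrm{op}}$,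 where an arrow $j:n\to m$ of $J$ is regarded as the arrow $n\to m$ of $T^{\mathrm{op}}$ given by $j^{-1}:m\to n$ in $T$; and this bimodule $J\to J$ carries a monad structure in $\mathrm{Mod}(\mathrm{Span}(\mathbf{Mon}))$ whose unit $J\to T^{\mathrm{op}}$ sends $j$ to that arrow $j^{-1}$ and whose multiplication $T^{\mathrm{op}}\otimes_J T^{\mathrm{op}}\to T^{\mathrm{op}}$ is composition in $T^{\mathrm{op}}$, $[f,g]\mapsto f;g$. -/

import Mathlib

open CategoryTheory Bicategory MonObj

universe w v u

namespace PropMonad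

/-! ### Monads and bimodules in a bicategory

A monad on `x` in a bicategory is a monoid object of the monoidal category of endomorphism 1-cells
`x ⟶ x` (the tensor product is composition, written `≫` in diagrammatic order). -/

section Bimodules

variable {B : Type u} [Bicategory.{w, v} B]

/-- A monad in the bicategory `B`, together with the object it lives on. -/
structure Mnd (B : Type u) [Bicategory.{w, v} B] where
  x : B
  t : x ⟶ x
  [mon : MonObj t]

attribute [instance] Mnd.mon

/-- The unit of a monad, as a 2-cell of `B`. -/
abbrev Mnd.unit (F : Mnd B) : 𝟙 F.x ⟶ F.t := η[F.t]

/-- The multiplication of a monad, as a 2-cell of `B`. -/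
abbrev Mnd.mult (F : Mnd B) : F.t ≫ F.t ⟶ F.t := μ[F.t]

/-- An `F`-`G`-bimodule structure on a 1-cell `H`. -/
structure BimodStr (F G : Mnd B) (H : F.x ⟶ G.x) where
  lact : F.t ≫ H ⟶ H
  ract : H ≫ G.t ⟶ H
  unit_lact : F.unit ▷ H ≫ lact = (λ_ H).hom
  mult_lact : F.mult ▷ H ≫ lact = (α_ F.t F.t H).hom ≫ F.t ◁ lact ≫ lact
  unit_ract : H ◁ G.unit ≫ ract = (ρ_ H).hom
  mult_ract : H ◁ G.mult ≫ ract = (α_ H G.t G.t).inv ≫ ract ▷ G.t ≫ ract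
  middle : lact ▷ G.t ≫ ract = (α_ F.t H G.t).hom ≫ F.t ◁ ract ≫ lact

/-- A bimodule from the monad `F` to the monad `G`. -/
structure Bimodule (F G : Mnd B) where
  H : F.x ⟶ G.x
  str : BimodStr F G H

namespace Bimodule

variable {F G : Mnd B}

abbrev lact (M : Bimodule F G) : F.t ≫ M.H ⟶ M.H := M.str.lact

abbrev ract (M : Bimodule F G) : M.H ≫ G.t ⟶ M.H := M.str.ract

/-- Morphisms of bimodules. -/
@[ext]
structure Hom (M N : Bimodule F G) where
  hom : M.H ⟶ N.H
  lact_hom : M.lact ≫ hom = F.t ◁ hom ≫ N.lact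
  ract_hom : M.ract ≫ hom = hom ▷ G.t ≫ N.ract

instance : Category (Bimodule F G) where
  Hom := Hom
  id M := { hom := 𝟙 M.H, lact_hom := by simp, ract_hom := by simp }
  comp f g :=
    { hom := f.hom ≫ g.hom
      lact_hom := by
        rw [← Category.assoc, f.lact_hom, Category.assoc, g.lact_hom]; simp
      ract_hom := by
        rw [← Category.assoc, f.ract_hom, Category.assoc, g.ract_hom]; simp }
  id_comp f := Hom.ext (Category.id_comp _)
  comp_id f := Hom.ext (Category.comp_id _)
  assoc f g h := Hom.ext (Category.assoc _ _ _)

/-- A monad, regarded as a bimodule over itself through its multiplication. -/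
def regular (F : Mnd B) : Bimodule F F where
  H := F.t
  str :=
    { lact := F.mult
      ract := F.mult
      unit_lact := MonObj.one_mul F.t
      mult_lact := MonObj.mul_assoc F.t
      unit_ract := MonObj.mul_one F.t
      mult_ract := by
        have h : F.mult ▷ F.t ≫ F.mult = (α_ F.t F.t F.t).hom ≫ F.t ◁ F.mult ≫ F.mult :=
          MonObj.mul_assoc F.t
        rw [h, Iso.inv_hom_id_assoc]
      middle := MonObj.mul_assoc F.t }

end Bimodule

end Bimodules

/-! ### The bicategory of spans of monoids -/

/-- Objects of `Span(Mon)`: monoids. -/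
structure SpanMon : Type (u + 1) where
  carrier : Type u
  [monoid : Monoid carrier]

attribute [instance] SpanMon.monoid

/-- 1-cells of `Span(Mon)`: spans of monoid homomorphisms. -/
structure Span (X Y : SpanMon.{u}) : Type (u + 1) where
  apex : Type u
  [monoid : Monoid apex]
  l : apex →* X.carrier
  r : apex →* Y.carrier

attribute [instance] Span.monoid

/-- 2-cells of `Span(Mon)`: morphisms of spans. -/
@[ext]
structure SpanHom {X Y : SpanMon.{u}} (S S' : Span X Y) : Type u where
  hom : S.apex →* S'.apex
  l_hom : ∀ a, S'.l (hom a) = S.l a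
  r_hom : ∀ a, S'.r (hom a) = S.r a

instance {X Y : SpanMon.{u}} : Category (Span X Y) where
  Hom := SpanHom
  id S := { hom := MonoidHom.id _, l_hom := fun _ => rfl, r_hom := fun _ => rfl }
  comp f g :=
    { hom := g.hom.comp f.hom
      l_hom := fun a => (g.l_hom _).trans (f.l_hom a)
      r_hom := fun a => (g.r_hom _).trans (f.r_hom a) }

/-- The pullback of two monoid homomorphisms with common codomain. -/
def pullbackMon {P Q R : Type u} [Monoid P] [Monoid Q] [Monoid R] (f : P →* R) (g : Q →* R) :
    Submonoid (P × Q) where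
  carrier := {p | f p.1 = g p.2}
  one_mem' := by simp
  mul_mem' := by
    intro a b ha hb
    change f (a.1 * b.1) = g (a.2 * b.2)
    rw [map_mul, map_mul, show f a.1 = g a.2 from ha, show f b.1 = g b.2 from hb]

namespace Span

variable {X Y Z W : SpanMon.{u}}

/-- The identity span. -/
def id (X : SpanMon.{u}) : Span X X where
  apex := X.carrier
  l := MonoidHom.id _
  r := MonoidHom.id _

/-- Composition of spans by pullback. -/
def comp (S : Span X Y) (T : Span Y Z) : Span X Z where
  apex := pullbackMon S.r T.l
  l := S.l.comp ((MonoidHom.fst _ _).comp (pullbackMon S.r T.l).subtype)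
  r := T.r.comp ((MonoidHom.snd _ _).comp (pullbackMon S.r T.l).subtype)

/-- The horizontal composite of two 2-cells. -/
def hcomp {S S' : Span X Y} {T T' : Span Y Z} (f : S ⟶ S') (g : T ⟶ T') :
    S.comp T ⟶ S'.comp T' where
  hom :=
    { toFun := fun p => ⟨(f.hom p.1.1, g.hom p.1.2),
        (f.r_hom _).trans (p.2.trans (g.l_hom _).symm)⟩
      map_one' := Subtype.ext (Prod.ext (map_one f.hom) (map_one g.hom))
      map_mul' := fun _ _ => Subtype.ext (Prod.ext (map_mul f.hom _ _) (map_mul g.hom _ _)) }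
  l_hom := fun p => f.l_hom p.1.1
  r_hom := fun p => g.r_hom p.1.2

/-- The associator, `((a, b), c) ↦ (a, (b, c))`. -/
def assoc (S : Span X Y) (T : Span Y Z) (U : Span Z W) :
    (S.comp T).comp U ≅ S.comp (T.comp U) where
  hom :=
    { hom :=
        { toFun := fun p => ⟨(p.1.1.1.1, ⟨(p.1.1.1.2, p.1.2), p.2⟩), p.1.1.2⟩
          map_one' := rfl
          map_mul' := fun _ _ => rfl }
      l_hom := fun _ => rfl
      r_hom := fun _ => rfl }
  inv :=
    { hom :=
        { toFun := fun p => ⟨(⟨(p.1.1, p.1.2.1.1), p.2⟩, p.1.2.1.2), p.1.2.2⟩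
          map_one' := rfl
          map_mul' := fun _ _ => rfl }
      l_hom := fun _ => rfl
      r_hom := fun _ => rfl }
  hom_inv_id := rfl
  inv_hom_id := rfl

/-- The left unitor, `(x, s) ↦ s`. -/
def leftUnitor (S : Span X Y) : (Span.id X).comp S ≅ S where
  hom :=
    { hom := (MonoidHom.snd _ _).comp (pullbackMon _ _).subtype
      l_hom := fun p => p.2.symm
      r_hom := fun _ => rfl }
  inv :=
    { hom :=
        { toFun := fun s => ⟨(S.l s, s), rfl⟩
          map_one' := Subtype.ext (Prod.ext (map_one S.l) rfl)
          map_mul' := fun _ _ => Subtype.ext (Prod.ext (map_mul S.l _ _) rfl) }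
      l_hom := fun _ => rfl
      r_hom := fun _ => rfl }
  hom_inv_id := SpanHom.ext (MonoidHom.ext fun p => Subtype.ext (Prod.ext p.2.symm rfl))
  inv_hom_id := rfl

/-- The right unitor, `(s, y) ↦ s`. -/
def rightUnitor (S : Span X Y) : S.comp (Span.id Y) ≅ S where
  hom :=
    { hom := (MonoidHom.fst _ _).comp (pullbackMon _ _).subtype
      l_hom := fun _ => rfl
      r_hom := fun p => p.2 }
  inv :=
    { hom :=
        { toFun := fun s => ⟨(s, S.r s), rfl⟩
          map_one' := Subtype.ext (Prod.ext rfl (map_one S.r))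
          map_mul' := fun _ _ => Subtype.ext (Prod.ext rfl (map_mul S.r _ _)) }
      l_hom := fun _ => rfl
      r_hom := fun _ => rfl }
  hom_inv_id := SpanHom.ext (MonoidHom.ext fun p => Subtype.ext (Prod.ext rfl p.2))
  inv_hom_id := rfl

end Span

/-- The bicategory `Span(Mon)`. -/
instance : Bicategory SpanMon.{u} where
  Hom X Y := Span X Y
  id X := Span.id X
  comp S T := S.comp T
  whiskerLeft S _ _ g := Span.hcomp (𝟙 S) g
  whiskerRight f T := Span.hcomp f (𝟙 T)
  associator := Span.assoc
  leftUnitor := Span.leftUnitor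
  rightUnitor := Span.rightUnitor
  whiskerLeft_id _ _ := rfl
  whiskerLeft_comp _ _ _ _ _ _ := rfl
  id_whiskerLeft f := by
    refine SpanHom.ext (MonoidHom.ext fun p => Subtype.ext (Prod.ext ?_ ?_))
    · exact p.2.trans (SpanHom.l_hom f _).symm
    · rfl
  comp_whiskerLeft _ _ _ _ _ := rfl
  id_whiskerRight _ _ := rfl
  comp_whiskerRight _ _ _ := rfl
  whiskerRight_id f := by
    refine SpanHom.ext (MonoidHom.ext fun p => Subtype.ext (Prod.ext ?_ ?_))
    · rfl
    · exact p.2.symm.trans (SpanHom.r_hom f _).symm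
  whiskerRight_comp _ _ _ := rfl
  whisker_assoc _ _ _ _ _ := rfl
  whisker_exchange _ _ := rfl
  pentagon _ _ _ _ := rfl
  triangle _ _ := rfl

/-! Elements of spans: `Ap S` is the apex of `S`, `src S` and `tgt S` are its legs, `ev f` is the
monoid homomorphism underlying a 2-cell `f`. -/

section Elements

variable {X Y Z W : SpanMon.{u}}

def Ap (S : X ⟶ Y) : Type u := Span.apex (X := X) (Y := Y) S

instance (S : X ⟶ Y) : Monoid (Ap S) := Span.monoid (X := X) (Y := Y) S

def src (S : X ⟶ Y) : Ap S →* X.carrier := Span.l (X := X) (Y := Y) S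

def tgt (S : X ⟶ Y) : Ap S →* Y.carrier := Span.r (X := X) (Y := Y) S

def ev {S T : X ⟶ Y} (f : S ⟶ T) : Ap S →* Ap T := SpanHom.hom (X := X) (Y := Y) f

/-- A 2-cell from its underlying monoid homomorphism. -/
def mkCell {S T : X ⟶ Y} (f : Ap S →* Ap T) (hl : ∀ a, src T (f a) = src S a)
    (hr : ∀ a, tgt T (f a) = tgt S a) : S ⟶ T :=
  SpanHom.mk (X := X) (Y := Y) f hl hr

/-- The element of a composite span given by a composable pair. -/
def pair (S : X ⟶ Y) (T : Y ⟶ Z) (a : Ap S) (b : Ap T) (h : tgt S a = src T b) :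
    Ap (S ≫ T) := ⟨(a, b), h⟩

theorem exists_pair {S : X ⟶ Y} {T : Y ⟶ Z} (p : Ap (S ≫ T)) :
    ∃ a b h, p = pair S T a b h := ⟨p.1.1, p.1.2, p.2, rfl⟩

theorem pair_congr {S : X ⟶ Y} {T : Y ⟶ Z} {a a' b b' h h'} (e : a = a') (e' : b = b') :
    pair S T a b h = pair S T a' b' h' := by
  subst e e'
  rfl

theorem src_ev {S T : X ⟶ Y} (f : S ⟶ T) (a : Ap S) : src T (ev f a) = src S a :=
  SpanHom.l_hom (X := X) (Y := Y) f a

theorem tgt_ev {S T : X ⟶ Y} (f : S ⟶ T) (a : Ap S) : tgt T (ev f a) = tgt S a :=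
  SpanHom.r_hom (X := X) (Y := Y) f a

theorem cell_ext {S T : X ⟶ Y} {f g : S ⟶ T} (h : ∀ a, ev f a = ev g a) : f = g :=
  SpanHom.ext (MonoidHom.ext h)

end Elements

/-! ### Composition of bimodules in `Span(Mon)` -/

section Tensor

variable {F D G E : Mnd SpanMon.{u}}

namespace Bimodule

/-- The left action on elements. -/
abbrev la (M : Bimodule F G) (a : Ap F.t) (m : Ap M.H) (h : tgt F.t a = src M.H m) : Ap M.H :=
  ev M.lact (pair F.t M.H a m h)

/-- The right action on elements. -/
abbrev ra (M : Bimodule F G) (m : Ap M.H) (b : Ap G.t) (h : tgt M.H m = src G.t b) : Ap M.H :=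
  ev M.ract (pair M.H G.t m b h)

theorem src_la (M : Bimodule F G) (a m h) : src M.H (M.la a m h) = src F.t a := src_ev M.lact _

theorem tgt_la (M : Bimodule F G) (a m h) : tgt M.H (M.la a m h) = tgt M.H m := tgt_ev M.lact _

theorem src_ra (M : Bimodule F G) (m b h) : src M.H (M.ra m b h) = src M.H m := src_ev M.ract _

theorem tgt_ra (M : Bimodule F G) (m b h) : tgt M.H (M.ra m b h) = tgt G.t b := tgt_ev M.ract _

theorem la_mult (M : Bimodule F G) (a b : Ap F.t) (m : Ap M.H) (h : tgt F.t a = src F.t b)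
    (h' : tgt F.t b = src M.H m) :
    M.la (ev F.mult (pair F.t F.t a b h)) m ((tgt_ev F.mult _).trans h') =
      M.la a (M.la b m h') (h.trans (M.src_la b m h').symm) :=
  DFunLike.congr_fun (congrArg ev M.str.mult_lact)
    (pair (F.t ≫ F.t) M.H (pair F.t F.t a b h) m h')

theorem ra_mult (M : Bimodule F G) (m : Ap M.H) (a b : Ap G.t) (h : tgt M.H m = src G.t a)
    (h' : tgt G.t a = src G.t b) :
    M.ra m (ev G.mult (pair G.t G.t a b h')) (h.trans (src_ev G.mult (pair G.t G.t a b h')).symm) =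
      M.ra (M.ra m a h) b ((M.tgt_ra m a h).trans h') :=
  DFunLike.congr_fun (congrArg ev M.str.mult_ract)
    (pair M.H (G.t ≫ G.t) m (pair G.t G.t a b h') h)

theorem ra_la (M : Bimodule F G) (a : Ap F.t) (m : Ap M.H) (b : Ap G.t)
    (h : tgt F.t a = src M.H m) (h' : tgt M.H m = src G.t b) :
    M.ra (M.la a m h) b ((M.tgt_la a m h).trans h') =
      M.la a (M.ra m b h') (h.trans (M.src_ra m b h').symm) :=
  DFunLike.congr_fun (congrArg ev M.str.middle)
    (pair (F.t ≫ M.H) G.t (pair F.t M.H a m h) b h')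

theorem la_unit (M : Bimodule F G) (x : Ap (𝟙 F.x)) (m : Ap M.H) (h) :
    M.la (ev F.unit x) m h = m :=
  DFunLike.congr_fun (congrArg ev M.str.unit_lact)
    (pair (𝟙 F.x) M.H x m ((tgt_ev F.unit x).symm.trans h))

theorem ra_unit (M : Bimodule F G) (m : Ap M.H) (x : Ap (𝟙 G.x)) (h) :
    M.ra m (ev G.unit x) h = m :=
  DFunLike.congr_fun (congrArg ev M.str.unit_ract)
    (pair M.H (𝟙 G.x) m x (h.trans (src_ev G.unit x)))

theorem hom_la {M N : Bimodule F G} (f : M ⟶ N) (a : Ap F.t) (m : Ap M.H) (h) :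
    ev (Hom.hom f) (M.la a m h) =
      N.la a (ev (Hom.hom f) m) (h.trans (src_ev (Hom.hom f) m).symm) :=
  DFunLike.congr_fun (congrArg ev (Hom.lact_hom f)) (pair F.t M.H a m h)

theorem hom_ra {M N : Bimodule F G} (f : M ⟶ N) (m : Ap M.H) (b : Ap G.t) (h) :
    ev (Hom.hom f) (M.ra m b h) =
      N.ra (ev (Hom.hom f) m) b ((tgt_ev (Hom.hom f) m).trans h) :=
  DFunLike.congr_fun (congrArg ev (Hom.ract_hom f)) (pair M.H G.t m b h)

theorem hom_ext {M N : Bimodule F G} {f g : M ⟶ N}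
    (h : ∀ a, ev (Hom.hom f) a = ev (Hom.hom g) a) : f = g :=
  Hom.ext (cell_ext h)

variable (M : Bimodule F D) (N : Bimodule D G)

/-- The first of the two parallel 2-cells coequalised by the tensor product. -/
abbrev parLeft : (M.H ≫ D.t) ≫ N.H ⟶ M.H ≫ N.H := M.ract ▷ N.H

/-- The second of the two parallel 2-cells coequalised by the tensor product. -/
abbrev parRight : (M.H ≫ D.t) ≫ N.H ⟶ M.H ≫ N.H := (α_ M.H D.t N.H).hom ≫ M.H ◁ N.lact

/-- `(m · d, n)` is related to `(m, d · n)`. -/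
def TensorRel (p q : Ap (M.H ≫ N.H)) : Prop :=
  ∃ t, ev (parLeft M N) t = p ∧ ev (parRight M N) t = q

/-- The equivalence relation generated by `TensorRel` is a monoid congruence. -/
def tensorCon : Con (Ap (M.H ≫ N.H)) where
  r := Relation.EqvGen (TensorRel M N)
  iseqv := Relation.EqvGen.is_equivalence _
  mul' := by
    have hrefl : ∀ p, TensorRel M N p p := by
      intro p
      obtain ⟨m, n, h, rfl⟩ := exists_pair p
      let x : Ap (𝟙 D.x) := tgt M.H m
      have hx : tgt M.H m = src D.t (ev D.unit x) := (src_ev D.unit x).symm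
      have hy : tgt D.t (ev D.unit x) = src N.H n := (tgt_ev D.unit x).trans h
      exact ⟨pair (M.H ≫ D.t) N.H (pair M.H D.t m (ev D.unit x) hx) n hy,
        pair_congr (M.ra_unit m x hx) rfl, pair_congr rfl (N.la_unit x n hy)⟩
    have hmul : ∀ p q p' q', TensorRel M N p q → TensorRel M N p' q' →
        TensorRel M N (p * p') (q * q') := by
      rintro _ _ _ _ ⟨s, rfl, rfl⟩ ⟨t, rfl, rfl⟩
      exact ⟨s * t, map_mul _ _ _, map_mul _ _ _⟩
    have h1 : ∀ c p q, Relation.EqvGen (TensorRel M N) p q →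
        Relation.EqvGen (TensorRel M N) (p * c) (q * c) := by
      intro c p q h
      induction h with
      | rel p q h => exact .rel _ _ (hmul _ _ _ _ h (hrefl c))
      | refl p => exact .refl _
      | symm p q _ ih => exact .symm _ _ ih
      | trans p q r _ _ ih ih' => exact .trans _ _ _ ih ih'
    have h2 : ∀ c p q, Relation.EqvGen (TensorRel M N) p q →
        Relation.EqvGen (TensorRel M N) (c * p) (c * q) := by
      intro c p q h
      induction h with
      | rel p q h => exact .rel _ _ (hmul _ _ _ _ (hrefl c) h)
      | refl p => exact .refl _
      | symm p q _ ih => exact .symm _ _ ih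
      | trans p q r _ _ ih ih' => exact .trans _ _ _ ih ih'
    intro p q p' q' h h'
    exact .trans _ _ _ (h1 _ _ _ h) (h2 _ _ _ h')

variable {M N} in
theorem tensorCon_legs {p q : Ap (M.H ≫ N.H)} (h : Relation.EqvGen (TensorRel M N) p q) :
    src (M.H ≫ N.H) p = src (M.H ≫ N.H) q ∧ tgt (M.H ≫ N.H) p = tgt (M.H ≫ N.H) q := by
  induction h with
  | rel p q h =>
    obtain ⟨t, rfl, rfl⟩ := h
    exact ⟨(src_ev _ t).trans (src_ev _ t).symm, (tgt_ev _ t).trans (tgt_ev _ t).symm⟩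
  | refl p => exact ⟨rfl, rfl⟩
  | symm p q _ ih => exact ⟨ih.1.symm, ih.2.symm⟩
  | trans p q r _ _ ih ih' => exact ⟨ih.1.trans ih'.1, ih.2.trans ih'.2⟩

/-- The span underlying the tensor product: composable pairs modulo the congruence generated by
`(m · d, n) ∼ (m, d · n)`. -/
def tensorSpan : F.x ⟶ G.x :=
  { apex := (tensorCon M N).Quotient
    l := (tensorCon M N).lift (src (M.H ≫ N.H)) fun _ _ h => (tensorCon_legs h).1
    r := (tensorCon M N).lift (tgt (M.H ≫ N.H)) fun _ _ h => (tensorCon_legs h).2 : Span F.x G.x }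

/-- The quotient map. -/
def proj : M.H ≫ N.H ⟶ tensorSpan M N :=
  mkCell (tensorCon M N).mk' (fun _ => rfl) (fun _ => rfl)

/-- The class of a composable pair in the tensor product. -/
def tmk (m : Ap M.H) (n : Ap N.H) (h : tgt M.H m = src N.H n) : Ap (tensorSpan M N) :=
  ev (proj M N) (pair M.H N.H m n h)

theorem proj_surjective : Function.Surjective (ev (proj M N)) :=
  (tensorCon M N).mk'_surjective

theorem proj_condition : parLeft M N ≫ proj M N = parRight M N ≫ proj M N :=
  cell_ext fun t => (Con.eq _).2 (.rel _ _ ⟨t, rfl, rfl⟩)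

theorem exists_tmk (q : Ap (tensorSpan M N)) : ∃ m n h, q = tmk M N m n h := by
  obtain ⟨p, rfl⟩ := proj_surjective M N q
  obtain ⟨m, n, h, rfl⟩ := exists_pair p
  exact ⟨m, n, h, rfl⟩

variable {M N} in
theorem tmk_congr {m m' n n' h h'} (e : m = m') (e' : n = n') :
    tmk M N m n h = tmk M N m' n' h' := by
  subst e e'
  rfl

theorem tmk_balanced (m : Ap M.H) (d : Ap D.t) (n : Ap N.H) (h : tgt M.H m = src D.t d)
    (h' : tgt D.t d = src N.H n) :
    tmk M N (M.ra m d h) n ((M.tgt_ra m d h).trans h') =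
      tmk M N m (N.la d n h') (h.trans (N.src_la d n h').symm) :=
  DFunLike.congr_fun (congrArg ev (proj_condition M N))
    (pair (M.H ≫ D.t) N.H (pair M.H D.t m d h) n h')

/-- 2-cells out of the tensor product. -/
def tdesc {T : F.x ⟶ G.x} (f : M.H ≫ N.H ⟶ T)
    (hf : parLeft M N ≫ f = parRight M N ≫ f) : tensorSpan M N ⟶ T :=
  mkCell
    ((tensorCon M N).lift (ev f) (by
      intro p q hpq
      have h : Relation.EqvGen (TensorRel M N) p q := hpq
      clear hpq
      change ev f p = ev f q
      induction h with
      | rel p q h =>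
        obtain ⟨t, rfl, rfl⟩ := h
        exact DFunLike.congr_fun (congrArg ev hf) t
      | refl p => rfl
      | symm p q _ ih => exact ih.symm
      | trans p q r _ _ ih ih' => exact ih.trans ih'))
    (fun q => by
      obtain ⟨m, n, h, rfl⟩ := exists_tmk M N q
      exact src_ev f (pair M.H N.H m n h))
    (fun q => by
      obtain ⟨m, n, h, rfl⟩ := exists_tmk M N q
      exact tgt_ev f (pair M.H N.H m n h))

/-- The tensor product is the coequaliser, in the category of spans from `F.x` to `G.x`, of the two
2-cells that let the middle monad act on the right of `M` and on the left of `N`. -/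
def projIsCoequalizer :
    Limits.IsColimit (Limits.Cofork.ofπ (proj M N) (proj_condition M N)) :=
  Limits.Cofork.IsColimit.mk _ (fun s => tdesc M N s.π s.condition)
    (fun s => cell_ext fun a => by
      obtain ⟨m, n, h, rfl⟩ := exists_pair a
      rfl)
    (fun s m hm => cell_ext fun q => by
      obtain ⟨a, rfl⟩ := proj_surjective M N q
      exact DFunLike.congr_fun (congrArg ev hm) a)

section Whisker

variable {Y Z : SpanMon.{u}}

/-- Whiskering by a span on the left preserves the coequaliser defining the tensor product. -/
def ldesc (A : Y ⟶ F.x) {T : Y ⟶ G.x} (f : A ≫ M.H ≫ N.H ⟶ T)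
    (hf : A ◁ parLeft M N ≫ f = A ◁ parRight M N ≫ f) : A ≫ tensorSpan M N ⟶ T :=
  have key : ∀ (a : Ap A) (p q : Ap (M.H ≫ N.H)), Relation.EqvGen (TensorRel M N) p q →
      ∀ h h', ev f (pair A (M.H ≫ N.H) a p h) = ev f (pair A (M.H ≫ N.H) a q h') := by
    intro a p q hpq
    induction hpq with
    | rel p q hpq =>
      obtain ⟨t, rfl, rfl⟩ := hpq
      intro h h'
      exact DFunLike.congr_fun (congrArg ev hf)
        (pair A ((M.H ≫ D.t) ≫ N.H) a t (h.trans (src_ev (parLeft M N) t)))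
    | refl p => intro h h'; rfl
    | symm p q _ ih => intro h h'; exact (ih h' h).symm
    | trans p q r hpq _ ih ih' =>
      intro h h'
      exact (ih h (h.trans (tensorCon_legs hpq).1)).trans (ih' _ h')
  mkCell
    { toFun := fun x => Quotient.hrecOn (s := (tensorCon M N).toSetoid)
        (motive := fun q : Ap (tensorSpan M N) => tgt A x.1.1 = src (tensorSpan M N) q → Ap T)
        x.1.2 (fun p h => ev f (pair A (M.H ≫ N.H) x.1.1 p h))
        (fun p q h => Function.hfunext
          (congrArg (fun z => tgt A x.1.1 = z) (tensorCon_legs h).1)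
          (fun h1 h2 _ => heq_of_eq (key x.1.1 p q h h1 h2))) x.2
      map_one' := map_one (ev f)
      map_mul' := by
        intro x y
        obtain ⟨a, q, h, rfl⟩ := exists_pair x
        obtain ⟨b, r, h', rfl⟩ := exists_pair y
        obtain ⟨p, rfl⟩ := proj_surjective M N q
        obtain ⟨p', rfl⟩ := proj_surjective M N r
        exact map_mul (ev f) (pair A (M.H ≫ N.H) a p h) (pair A (M.H ≫ N.H) b p' h') }
    (fun x => by
      obtain ⟨a, q, h, rfl⟩ := exists_pair x
      obtain ⟨p, rfl⟩ := proj_surjective M N q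
      exact src_ev f (pair A (M.H ≫ N.H) a p h))
    (fun x => by
      obtain ⟨a, q, h, rfl⟩ := exists_pair x
      obtain ⟨p, rfl⟩ := proj_surjective M N q
      exact tgt_ev f (pair A (M.H ≫ N.H) a p h))

/-- Whiskering by a span on the right preserves the coequaliser defining the tensor product. -/
def rdesc (A : G.x ⟶ Z) {T : F.x ⟶ Z} (f : (M.H ≫ N.H) ≫ A ⟶ T)
    (hf : parLeft M N ▷ A ≫ f = parRight M N ▷ A ≫ f) : tensorSpan M N ≫ A ⟶ T :=
  have key : ∀ (a : Ap A) (p q : Ap (M.H ≫ N.H)), Relation.EqvGen (TensorRel M N) p q →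
      ∀ h h', ev f (pair (M.H ≫ N.H) A p a h) = ev f (pair (M.H ≫ N.H) A q a h') := by
    intro a p q hpq
    induction hpq with
    | rel p q hpq =>
      obtain ⟨t, rfl, rfl⟩ := hpq
      intro h h'
      exact DFunLike.congr_fun (congrArg ev hf)
        (pair ((M.H ≫ D.t) ≫ N.H) A t a ((tgt_ev (parLeft M N) t).symm.trans h))
    | refl p => intro h h'; rfl
    | symm p q _ ih => intro h h'; exact (ih h' h).symm
    | trans p q r hpq _ ih ih' =>
      intro h h'
      exact (ih h ((tensorCon_legs hpq).2.symm.trans h)).trans (ih' _ h')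
  mkCell
    { toFun := fun x => Quotient.hrecOn (s := (tensorCon M N).toSetoid)
        (motive := fun q : Ap (tensorSpan M N) => tgt (tensorSpan M N) q = src A x.1.2 → Ap T)
        x.1.1 (fun p h => ev f (pair (M.H ≫ N.H) A p x.1.2 h))
        (fun p q h => Function.hfunext
          (congrArg (fun z => z = src A x.1.2) (tensorCon_legs h).2)
          (fun h1 h2 _ => heq_of_eq (key x.1.2 p q h h1 h2))) x.2
      map_one' := map_one (ev f)
      map_mul' := by
        intro x y
        obtain ⟨q, a, h, rfl⟩ := exists_pair x
        obtain ⟨r, b, h', rfl⟩ := exists_pair y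
        obtain ⟨p, rfl⟩ := proj_surjective M N q
        obtain ⟨p', rfl⟩ := proj_surjective M N r
        exact map_mul (ev f) (pair (M.H ≫ N.H) A p a h) (pair (M.H ≫ N.H) A p' b h') }
    (fun x => by
      obtain ⟨q, a, h, rfl⟩ := exists_pair x
      obtain ⟨p, rfl⟩ := proj_surjective M N q
      exact src_ev f (pair (M.H ≫ N.H) A p a h))
    (fun x => by
      obtain ⟨q, a, h, rfl⟩ := exists_pair x
      obtain ⟨p, rfl⟩ := proj_surjective M N q
      exact tgt_ev f (pair (M.H ≫ N.H) A p a h))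

end Whisker

/-- The tensor product of two bimodules over the middle monad, with
`a · [m, n] = [a · m, n]` and `[m, n] · b = [m, n · b]`. -/
def tensor : Bimodule F G where
  H := tensorSpan M N
  str :=
    { lact := ldesc M N F.t ((α_ F.t M.H N.H).inv ≫ M.lact ▷ N.H ≫ proj M N) (by
        refine cell_ext fun x => ?_
        obtain ⟨a, y, h, rfl⟩ := exists_pair x
        obtain ⟨z, n, h', rfl⟩ := exists_pair y
        obtain ⟨m, d, h'', rfl⟩ := exists_pair z
        exact (tmk_congr (M.ra_la a m d h h'').symm rfl).trans
          (tmk_balanced M N (M.la a m h) d n ((M.tgt_la a m h).trans h'') h'))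
      ract := rdesc M N G.t ((α_ M.H N.H G.t).hom ≫ M.H ◁ N.ract ≫ proj M N) (by
        refine cell_ext fun x => ?_
        obtain ⟨y, b, h, rfl⟩ := exists_pair x
        obtain ⟨z, n, h', rfl⟩ := exists_pair y
        obtain ⟨m, d, h'', rfl⟩ := exists_pair z
        exact (tmk_balanced M N m d (N.ra n b h) h'' (h'.trans (N.src_ra n b h).symm)).trans
          (tmk_congr rfl (N.ra_la d n b h' h).symm))
      unit_lact := cell_ext fun x => by
        obtain ⟨a, q, h, rfl⟩ := exists_pair x
        obtain ⟨m, n, h', rfl⟩ := exists_tmk M N q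
        exact tmk_congr (M.la_unit a m ((tgt_ev F.unit a).trans h)) rfl
      mult_lact := cell_ext fun x => by
        obtain ⟨y, q, h, rfl⟩ := exists_pair x
        obtain ⟨m, n, h', rfl⟩ := exists_tmk M N q
        obtain ⟨a, b, h'', rfl⟩ := exists_pair y
        exact tmk_congr (M.la_mult a b m h'' h) rfl
      unit_ract := cell_ext fun x => by
        obtain ⟨q, b, h, rfl⟩ := exists_pair x
        obtain ⟨m, n, h', rfl⟩ := exists_tmk M N q
        exact tmk_congr rfl (N.ra_unit n b (h.trans (src_ev G.unit b).symm))
      mult_ract := cell_ext fun x => by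
        obtain ⟨q, y, h, rfl⟩ := exists_pair x
        obtain ⟨m, n, h', rfl⟩ := exists_tmk M N q
        obtain ⟨a, b, h'', rfl⟩ := exists_pair y
        exact tmk_congr rfl (N.ra_mult n a b h h'')
      middle := cell_ext fun x => by
        obtain ⟨y, b, h, rfl⟩ := exists_pair x
        obtain ⟨a, q, h', rfl⟩ := exists_pair y
        obtain ⟨m, n, h'', rfl⟩ := exists_tmk M N q
        rfl }

variable {M N}

/-- `[m, n] ↦ [m, f n]`. -/
def whiskerL (M : Bimodule F D) {N N' : Bimodule D G} (f : N ⟶ N') :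
    tensor M N ⟶ tensor M N' :=
  Hom.mk (M := tensor M N) (N := tensor M N')
    (tdesc M N (M.H ◁ Hom.hom f ≫ proj M N') (by
      refine cell_ext fun x => ?_
      obtain ⟨y, n, h, rfl⟩ := exists_pair x
      obtain ⟨m, d, h', rfl⟩ := exists_pair y
      exact (tmk_balanced M N' m d (ev (Hom.hom f) n) h' (h.trans (src_ev (Hom.hom f) n).symm)).trans
        (tmk_congr rfl (hom_la f d n h).symm)))
    (cell_ext fun x => by
      obtain ⟨a, q, h, rfl⟩ := exists_pair x
      obtain ⟨m, n, h', rfl⟩ := exists_tmk M N q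
      rfl)
    (cell_ext fun x => by
      obtain ⟨q, b, h, rfl⟩ := exists_pair x
      obtain ⟨m, n, h', rfl⟩ := exists_tmk M N q
      exact tmk_congr rfl (hom_ra f n b h))

/-- `[m, n] ↦ [f m, n]`. -/
def whiskerR {M M' : Bimodule F D} (f : M ⟶ M') (N : Bimodule D G) :
    tensor M N ⟶ tensor M' N :=
  Hom.mk (M := tensor M N) (N := tensor M' N)
    (tdesc M N (Hom.hom f ▷ N.H ≫ proj M' N) (by
      refine cell_ext fun x => ?_
      obtain ⟨y, n, h, rfl⟩ := exists_pair x
      obtain ⟨m, d, h', rfl⟩ := exists_pair y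
      exact (tmk_congr (hom_ra f m d h') rfl).trans
        (tmk_balanced M' N (ev (Hom.hom f) m) d n ((tgt_ev (Hom.hom f) m).trans h') h)))
    (cell_ext fun x => by
      obtain ⟨a, q, h, rfl⟩ := exists_pair x
      obtain ⟨m, n, h', rfl⟩ := exists_tmk M N q
      exact tmk_congr (hom_la f a m h) rfl)
    (cell_ext fun x => by
      obtain ⟨q, b, h, rfl⟩ := exists_pair x
      obtain ⟨m, n, h', rfl⟩ := exists_tmk M N q
      rfl)

/-- `[[l, m], n] ↦ [l, [m, n]]`, on spans. -/
def assocHom (L : Bimodule F D) (M : Bimodule D E) (N : Bimodule E G) :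
    tensorSpan (tensor L M) N ⟶ tensorSpan L (tensor M N) :=
  tdesc (tensor L M) N
    (rdesc L M N.H ((α_ L.H M.H N.H).hom ≫ L.H ◁ proj M N ≫ proj L (tensor M N)) (by
      refine cell_ext fun x => ?_
      obtain ⟨y, n, h, rfl⟩ := exists_pair x
      obtain ⟨z, m, h', rfl⟩ := exists_pair y
      obtain ⟨l, d, h'', rfl⟩ := exists_pair z
      exact tmk_balanced L (tensor M N) l d (tmk M N m n h) h'' h'))
    (by
      refine cell_ext fun x => ?_
      obtain ⟨y, n, h, rfl⟩ := exists_pair x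
      obtain ⟨q, e, h', rfl⟩ := exists_pair y
      obtain ⟨l, m, h'', rfl⟩ := exists_tmk L M q
      have key := tmk_balanced M N m e n h' h
      have h1 : tgt L.H l = src (tensorSpan M N)
        (tmk M N (M.ra m e h') n ((M.tgt_ra m e h').trans h)) := h''.trans (M.src_ra m e h').symm
      change tmk L (tensor M N) l (tmk M N (M.ra m e h') n ((M.tgt_ra m e h').trans h)) h1 =
        tmk L (tensor M N) l (tmk M N m (N.la e n h) (h'.trans (N.src_la e n h).symm)) h''
      exact tmk_congr (M := L) (N := tensor M N) rfl key)

/-- `[l, [m, n]] ↦ [[l, m], n]`, on spans. -/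
def assocInv (L : Bimodule F D) (M : Bimodule D E) (N : Bimodule E G) :
    tensorSpan L (tensor M N) ⟶ tensorSpan (tensor L M) N :=
  tdesc L (tensor M N)
    (ldesc M N L.H ((α_ L.H M.H N.H).inv ≫ proj L M ▷ N.H ≫ proj (tensor L M) N) (by
      refine cell_ext fun x => ?_
      obtain ⟨l, y, h, rfl⟩ := exists_pair x
      obtain ⟨z, n, h', rfl⟩ := exists_pair y
      obtain ⟨m, e, h'', rfl⟩ := exists_pair z
      exact tmk_balanced (tensor L M) N (tmk L M l m h) e n h'' h'))
    (by
      refine cell_ext fun x => ?_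
      obtain ⟨y, q, h, rfl⟩ := exists_pair x
      obtain ⟨l, d, h', rfl⟩ := exists_pair y
      obtain ⟨m, n, h'', rfl⟩ := exists_tmk M N q
      have key := tmk_balanced L M l d m h' h
      have h1 : tgt (tensorSpan L M)
        (tmk L M l (M.la d m h) (h'.trans (M.src_la d m h).symm)) = src N.H n :=
          (M.tgt_la d m h).trans h''
      change tmk (tensor L M) N (tmk L M (L.ra l d h') m ((L.tgt_ra l d h').trans h)) n h'' =
        tmk (tensor L M) N (tmk L M l (M.la d m h) (h'.trans (M.src_la d m h).symm)) n h1
      exact tmk_congr (M := tensor L M) (N := N) key rfl)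

/-- The associativity isomorphism of the tensor product. -/
def assoc (L : Bimodule F D) (M : Bimodule D E) (N : Bimodule E G) :
    tensor (tensor L M) N ≅ tensor L (tensor M N) where
  hom := Hom.mk (M := tensor (tensor L M) N) (N := tensor L (tensor M N)) (assocHom L M N)
    (cell_ext fun x => by
      obtain ⟨a, q, h, rfl⟩ := exists_pair x
      obtain ⟨r, n, h', rfl⟩ := exists_tmk (tensor L M) N q
      obtain ⟨l, m, h'', rfl⟩ := exists_tmk L M r
      rfl)
    (cell_ext fun x => by
      obtain ⟨q, a, h, rfl⟩ := exists_pair x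
      obtain ⟨r, n, h', rfl⟩ := exists_tmk (tensor L M) N q
      obtain ⟨l, m, h'', rfl⟩ := exists_tmk L M r
      rfl)
  inv := Hom.mk (M := tensor L (tensor M N)) (N := tensor (tensor L M) N) (assocInv L M N)
    (cell_ext fun x => by
      obtain ⟨a, q, h, rfl⟩ := exists_pair x
      obtain ⟨l, r, h', rfl⟩ := exists_tmk L (tensor M N) q
      obtain ⟨m, n, h'', rfl⟩ := exists_tmk M N r
      rfl)
    (cell_ext fun x => by
      obtain ⟨q, a, h, rfl⟩ := exists_pair x
      obtain ⟨l, r, h', rfl⟩ := exists_tmk L (tensor M N) q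
      obtain ⟨m, n, h'', rfl⟩ := exists_tmk M N r
      rfl)
  hom_inv_id := hom_ext fun q => by
    obtain ⟨r, n, h', rfl⟩ := exists_tmk (tensor L M) N q
    obtain ⟨l, m, h'', rfl⟩ := exists_tmk L M r
    rfl
  inv_hom_id := hom_ext fun q => by
    obtain ⟨l, r, h', rfl⟩ := exists_tmk L (tensor M N) q
    obtain ⟨m, n, h'', rfl⟩ := exists_tmk M N r
    rfl

/-- `[id, a · m] = [a, m]`. -/
theorem unit_tmk (M : Bimodule F G) (a : Ap F.t) (m : Ap M.H) (h : tgt F.t a = src M.H m)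
    (x : Ap (𝟙 F.x)) (hx : x = src F.t a) (h') :
    tmk (regular F) M (ev F.unit x) (M.la a m h) h' = tmk (regular F) M a m h := by
  subst hx
  have hx : tgt F.t (ev F.unit (src F.t a)) = src F.t a := tgt_ev F.unit (src F.t a)
  exact (tmk_balanced (regular F) M (ev F.unit (src F.t a)) a m hx h).symm.trans
    (tmk_congr (M := regular F) (N := M) ((regular F).la_unit (src F.t a) a hx) rfl)

/-- `[m · a, id] = [m, a]`. -/
theorem tmk_unit (M : Bimodule F G) (m : Ap M.H) (a : Ap G.t) (h : tgt M.H m = src G.t a)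
    (x : Ap (𝟙 G.x)) (hx : x = tgt G.t a) (h') :
    tmk M (regular G) (M.ra m a h) (ev G.unit x) h' = tmk M (regular G) m a h := by
  subst hx
  have hx : tgt G.t a = src G.t (ev G.unit (tgt G.t a)) := (src_ev G.unit (tgt G.t a)).symm
  exact (tmk_balanced M (regular G) m a (ev G.unit (tgt G.t a)) h hx).trans
    (tmk_congr (M := M) (N := regular G) rfl ((regular G).ra_unit a (tgt G.t a) hx))

/-- `[a, m] ↦ a · m`, with inverse `m ↦ [id, m]`. -/
def leftUnitor (M : Bimodule F G) : tensor (regular F) M ≅ M where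
  hom := Hom.mk (M := tensor (regular F) M) (N := M)
    (tdesc (regular F) M M.lact (cell_ext fun x => by
      obtain ⟨y, m, h, rfl⟩ := exists_pair x
      obtain ⟨a, b, h', rfl⟩ := exists_pair y
      exact M.la_mult a b m h' h))
    (cell_ext fun x => by
      obtain ⟨a, q, h, rfl⟩ := exists_pair x
      obtain ⟨b, m, h', rfl⟩ := exists_tmk (regular F) M q
      exact M.la_mult a b m h h')
    (cell_ext fun x => by
      obtain ⟨q, b, h, rfl⟩ := exists_pair x
      obtain ⟨a, m, h', rfl⟩ := exists_tmk (regular F) M q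
      exact (M.ra_la a m b h' h).symm)
  inv := Hom.mk (M := M) (N := tensor (regular F) M)
    ((λ_ M.H).inv ≫ F.unit ▷ M.H ≫ proj (regular F) M)
    (cell_ext fun x => by
      obtain ⟨a, m, h, rfl⟩ := exists_pair x
      refine (unit_tmk M a m h (src M.H (M.la a m h)) (M.src_la a m h) ?_).trans
        (tmk_congr (M := regular F) (N := M)
          ((regular F).ra_unit a (src M.H m) (h.trans (src_ev F.unit (src M.H m)).symm)).symm rfl))
    (cell_ext fun x => by
      obtain ⟨m, b, h, rfl⟩ := exists_pair x
      exact tmk_congr (M := regular F) (N := M) (congrArg (ev F.unit) (M.src_ra m b h)) rfl)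
  hom_inv_id := hom_ext fun q => by
    obtain ⟨a, m, h, rfl⟩ := exists_tmk (regular F) M q
    exact unit_tmk M a m h (src M.H (M.la a m h)) (M.src_la a m h) (tgt_ev F.unit (src M.H (M.la a m h)))
  inv_hom_id := hom_ext fun m => M.la_unit (src M.H m) m (tgt_ev F.unit (src M.H m))

/-- `[m, b] ↦ m · b`, with inverse `m ↦ [m, id]`. -/
def rightUnitor (M : Bimodule F G) : tensor M (regular G) ≅ M where
  hom := Hom.mk (M := tensor M (regular G)) (N := M)
    (tdesc M (regular G) M.ract (cell_ext fun x => by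
      obtain ⟨y, b, h, rfl⟩ := exists_pair x
      obtain ⟨m, a, h', rfl⟩ := exists_pair y
      exact (M.ra_mult m a b h' h).symm))
    (cell_ext fun x => by
      obtain ⟨a, q, h, rfl⟩ := exists_pair x
      obtain ⟨m, b, h', rfl⟩ := exists_tmk M (regular G) q
      exact M.ra_la a m b h h')
    (cell_ext fun x => by
      obtain ⟨q, b, h, rfl⟩ := exists_pair x
      obtain ⟨m, a, h', rfl⟩ := exists_tmk M (regular G) q
      exact M.ra_mult m a b h' h)
  inv := Hom.mk (M := M) (N := tensor M (regular G))
    ((ρ_ M.H).inv ≫ M.H ◁ G.unit ≫ proj M (regular G))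
    (cell_ext fun x => by
      obtain ⟨a, m, h, rfl⟩ := exists_pair x
      exact tmk_congr (M := M) (N := regular G) rfl (congrArg (ev G.unit) (M.tgt_la a m h)))
    (cell_ext fun x => by
      obtain ⟨m, b, h, rfl⟩ := exists_pair x
      exact (tmk_unit M m b h (tgt M.H (M.ra m b h)) (M.tgt_ra m b h)
        (src_ev G.unit (tgt M.H (M.ra m b h))).symm).trans
        (tmk_congr (M := M) (N := regular G) rfl
          ((regular G).la_unit (tgt M.H m) b ((tgt_ev G.unit (tgt M.H m)).trans h)).symm))
  hom_inv_id := hom_ext fun q => by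
    obtain ⟨m, b, h, rfl⟩ := exists_tmk M (regular G) q
    exact tmk_unit M m b h (tgt M.H (M.ra m b h)) (M.tgt_ra m b h)
      (src_ev G.unit (tgt M.H (M.ra m b h))).symm
  inv_hom_id := hom_ext fun m =>
    M.ra_unit m (tgt M.H m) (src_ev G.unit (tgt M.H m)).symm

end Bimodule

/-- The bicategory `Mod(Span(Mon))`: monads in `Span(Mon)`, bimodules and bimodule morphisms. -/
instance : Bicategory (Mnd SpanMon.{u}) where
  Hom F G := Bimodule F G
  id F := Bimodule.regular F
  comp M N := Bimodule.tensor M N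
  whiskerLeft M _ _ f := Bimodule.whiskerL M f
  whiskerRight f N := Bimodule.whiskerR f N
  associator := Bimodule.assoc
  leftUnitor := Bimodule.leftUnitor
  rightUnitor := Bimodule.rightUnitor
  whiskerLeft_id M N := by
    refine Bimodule.hom_ext fun q => ?_
    obtain ⟨m, n, h, rfl⟩ := Bimodule.exists_tmk M N q
    rfl
  whiskerLeft_comp M N _ _ f g := by
    refine Bimodule.hom_ext fun q => ?_
    obtain ⟨m, n, h, rfl⟩ := Bimodule.exists_tmk M N q
    rfl
  id_whiskerLeft {F G M N} f := by
    refine Bimodule.hom_ext fun q => ?_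
    obtain ⟨a, m, h, rfl⟩ := Bimodule.exists_tmk (Bimodule.regular F) M q
    have h1 : tgt F.t a = src N.H (ev (Bimodule.Hom.hom f) m) :=
      h.trans (src_ev (Bimodule.Hom.hom f) m).symm
    have h2 : src F.t a = src N.H (ev (Bimodule.Hom.hom f) (M.la a m h)) :=
      ((src_ev (Bimodule.Hom.hom f) (M.la a m h)).trans (M.src_la a m h)).symm
    exact (Bimodule.unit_tmk N a (ev (Bimodule.Hom.hom f) m) h1 (src F.t a) rfl
      ((tgt_ev F.unit (src F.t a)).trans (N.src_la a _ h1).symm)).symm.trans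
      (Bimodule.tmk_congr (M := Bimodule.regular F) (N := N) (congrArg (ev F.unit) h2)
        (Bimodule.hom_la f a m h).symm)
  comp_whiskerLeft L M N N' f := by
    refine Bimodule.hom_ext fun q => ?_
    obtain ⟨r, n, h, rfl⟩ := Bimodule.exists_tmk (Bimodule.tensor L M) N q
    obtain ⟨l, m, h', rfl⟩ := Bimodule.exists_tmk L M r
    rfl
  id_whiskerRight M N := by
    refine Bimodule.hom_ext fun q => ?_
    obtain ⟨m, n, h, rfl⟩ := Bimodule.exists_tmk M N q
    rfl
  comp_whiskerRight {F D G M _ _} f g N := by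
    refine Bimodule.hom_ext fun q => ?_
    obtain ⟨m, n, h, rfl⟩ := Bimodule.exists_tmk M N q
    rfl
  whiskerRight_id {F G M N} f := by
    refine Bimodule.hom_ext fun q => ?_
    obtain ⟨m, b, h, rfl⟩ := Bimodule.exists_tmk M (Bimodule.regular G) q
    have h1 : tgt N.H (ev (Bimodule.Hom.hom f) m) = src G.t b :=
      (tgt_ev (Bimodule.Hom.hom f) m).trans h
    have h2 : tgt G.t b = tgt N.H (ev (Bimodule.Hom.hom f) (M.ra m b h)) :=
      ((tgt_ev (Bimodule.Hom.hom f) (M.ra m b h)).trans (M.tgt_ra m b h)).symm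
    exact (Bimodule.tmk_unit N (ev (Bimodule.Hom.hom f) m) b h1 (tgt G.t b) rfl
      ((N.tgt_ra _ b h1).trans (src_ev G.unit (tgt G.t b)).symm)).symm.trans
      (Bimodule.tmk_congr (M := N) (N := Bimodule.regular G) (Bimodule.hom_ra f m b h).symm
        (congrArg (ev G.unit) h2))
  whiskerRight_comp {_ _ _ _ M M'} f N P := by
    refine Bimodule.hom_ext fun q => ?_
    obtain ⟨m, r, h, rfl⟩ := Bimodule.exists_tmk M (Bimodule.tensor N P) q
    obtain ⟨n, p, h', rfl⟩ := Bimodule.exists_tmk N P r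
    rfl
  whisker_assoc M N N' f P := by
    refine Bimodule.hom_ext fun q => ?_
    obtain ⟨r, p, h, rfl⟩ := Bimodule.exists_tmk (Bimodule.tensor M N) P q
    obtain ⟨m, n, h', rfl⟩ := Bimodule.exists_tmk M N r
    rfl
  whisker_exchange {_ _ _ M M' N N'} f g := by
    refine Bimodule.hom_ext fun q => ?_
    obtain ⟨m, n, h, rfl⟩ := Bimodule.exists_tmk M N q
    rfl
  pentagon M N P Q := by
    refine Bimodule.hom_ext fun q => ?_
    obtain ⟨r, d, h, rfl⟩ := Bimodule.exists_tmk (Bimodule.tensor (Bimodule.tensor M N) P) Q q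
    obtain ⟨s, c, h', rfl⟩ := Bimodule.exists_tmk (Bimodule.tensor M N) P r
    obtain ⟨a, b, h'', rfl⟩ := Bimodule.exists_tmk M N s
    rfl
  triangle {F D G} M N := by
    refine Bimodule.hom_ext fun q => ?_
    obtain ⟨r, n, h, rfl⟩ := Bimodule.exists_tmk (Bimodule.tensor M (Bimodule.regular D)) N q
    obtain ⟨m, d, h', rfl⟩ := Bimodule.exists_tmk M (Bimodule.regular D) r
    exact (Bimodule.tmk_balanced M N m d n h' h).symm

end Tensor

/-! ### PROPs -/

/-- A PROP: a symmetric strict monoidal category whose objects are the natural numbers and whose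
monoidal product on objects is addition. Composition `comp f g` is in diagrammatic order. The strict
associativity and unit laws compare arrows with equal sources and equal targets, hence `HEq`. -/
structure PROP where
  Hom : ℕ → ℕ → Type u
  id (n : ℕ) : Hom n n
  comp {n m k : ℕ} : Hom n m → Hom m k → Hom n k
  id_comp {n m : ℕ} (f : Hom n m) : comp (id n) f = f
  comp_id {n m : ℕ} (f : Hom n m) : comp f (id m) = f
  comp_assoc {n m k l : ℕ} (f : Hom n m) (g : Hom m k) (h : Hom k l) :
    comp (comp f g) h = comp f (comp g h)
  /-- The monoidal product on arrows. -/
  tensor {n m n' m' : ℕ} : Hom n m → Hom n' m' → Hom (n + n') (m + m')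
  tensor_id (n m : ℕ) : tensor (id n) (id m) = id (n + m)
  tensor_comp {n m k n' m' k' : ℕ} (f : Hom n m) (g : Hom m k) (f' : Hom n' m') (g' : Hom m' k') :
    tensor (comp f g) (comp f' g') = comp (tensor f f') (tensor g g')
  tensor_assoc {n m n' m' n'' m'' : ℕ} (f : Hom n m) (g : Hom n' m') (h : Hom n'' m'') :
    HEq (tensor (tensor f g) h) (tensor f (tensor g h))
  id_zero_tensor {n m : ℕ} (f : Hom n m) : HEq (tensor (id 0) f) f
  tensor_id_zero {n m : ℕ} (f : Hom n m) : HEq (tensor f (id 0)) f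
  /-- The symmetry. -/
  symm (n m : ℕ) : Hom (n + m) (m + n)
  symm_naturality {n m n' m' : ℕ} (f : Hom n m) (g : Hom n' m') :
    comp (tensor f g) (symm m m') = comp (symm n n') (tensor g f)
  symm_symm (n m : ℕ) : comp (symm n m) (symm m n) = id (n + m)
  /-- The first hexagon: up to associativity of addition, `symm n (m + k)` is the composite of
  `symm n m ⊗ id k` and `id m ⊗ symm n k`. -/
  symm_add (n m k : ℕ) (a : Hom (n + m + k) (m + n + k)) (b : Hom (m + n + k) (m + k + n)) :
    HEq a (tensor (symm n m) (id k)) → HEq b (tensor (id m) (symm n k)) →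
      HEq (symm n (m + k)) (comp a b)
  /-- The second hexagon: up to associativity of addition, `symm (n + m) k` is the composite of
  `id n ⊗ symm m k` and `symm n k ⊗ id m`. -/
  add_symm (n m k : ℕ) (a : Hom (n + m + k) (n + k + m)) (b : Hom (n + k + m) (k + n + m)) :
    HEq a (tensor (id n) (symm m k)) → HEq b (tensor (symm n k) (id m)) →
      HEq (symm (n + m) k) (comp a b)

namespace PROP

variable (T : PROP.{u})

/-- The set of all arrows of `T`. -/
@[ext]
structure Arr where
  dom : ℕ
  cod : ℕ
  hom : T.Hom dom cod

variable {T} in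
/-- An arrow of `T`, as an element of the set of all arrows. -/
def arr {n m : ℕ} (f : T.Hom n m) : T.Arr := ⟨n, m, f⟩

variable {T} in
theorem arr_heq {n m n' m' : ℕ} (hn : n = n') (hm : m = m') {f : T.Hom n m} {g : T.Hom n' m'}
    (h : HEq f g) : arr f = arr g := by
  subst hn hm
  rw [eq_of_heq h]

/-- The arrows of `T` form a monoid under the monoidal product. -/
instance : Monoid T.Arr where
  mul f g := arr (T.tensor f.hom g.hom)
  one := arr (T.id 0)
  mul_assoc f g h := arr_heq (add_assoc _ _ _) (add_assoc _ _ _) (T.tensor_assoc _ _ _)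
  one_mul f := arr_heq (zero_add _) (zero_add _) (T.id_zero_tensor _)
  mul_one f := arr_heq (add_zero _) (add_zero _) (T.tensor_id_zero _)

/-- Composition of composable arrows. -/
def compArr (f g : T.Arr) (h : f.cod = g.dom) : T.Arr :=
  arr (T.comp f.hom (cast (by rw [h]) g.hom))

end PROP

/-- The monoid `(ℕ, +, 0)`, in multiplicative notation. -/
def natMon : SpanMon.{u} := ⟨ULift.{u} (Multiplicative ℕ)⟩

/-- The natural number `n` as an element of `natMon`. -/
def ob (n : ℕ) : natMon.{u}.carrier := ULift.up (Multiplicative.ofAdd n)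

theorem ob_inj {n m : ℕ} (h : ob.{u} n = ob m) : n = m :=
  Multiplicative.ofAdd.injective (ULift.up_injective h)

namespace PROP

variable (T : PROP.{u})

/-- The span `ℕ ← Ar(T) → ℕ` given by source and target. -/
def span : natMon.{u} ⟶ natMon.{u} :=
  { apex := T.Arr
    l := { toFun := fun f => ob f.dom, map_one' := rfl, map_mul' := fun _ _ => rfl }
    r := { toFun := fun f => ob f.cod, map_one' := rfl, map_mul' := fun _ _ => rfl } :
      Span natMon.{u} natMon.{u} }

variable {T} in
/-- An arrow of `T`, as an element of the apex of the span of `T`. -/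
def el {n m : ℕ} (f : T.Hom n m) : Ap T.span := arr f

theorem exists_el (f : Ap T.span) : ∃ (n m : ℕ) (g : T.Hom n m), f = el g :=
  ⟨f.dom, f.cod, f.hom, rfl⟩

/-- The 2-cell given by identity arrows. -/
def unitCell : 𝟙 natMon.{u} ⟶ T.span :=
  mkCell (S := 𝟙 natMon.{u}) (T := T.span)
    { toFun := fun n : ULift.{u} (Multiplicative ℕ) => el (T.id (Multiplicative.toAdd n.down))
      map_one' := rfl
      map_mul' := fun _ _ => congrArg (arr (T := T)) (T.tensor_id _ _).symm }
    (fun _ => rfl) (fun _ => rfl)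

/-- The 2-cell given by composition of arrows. -/
def multCell : T.span ≫ T.span ⟶ T.span :=
  mkCell (S := T.span ≫ T.span) (T := T.span)
    { toFun := fun p => T.compArr p.1.1 p.1.2 (ob_inj p.2)
      map_one' := congrArg (arr (T := T)) (T.id_comp (T.id 0))
      map_mul' := by
        intro p q
        obtain ⟨f, g, h, rfl⟩ := exists_pair p
        obtain ⟨f', g', h', rfl⟩ := exists_pair q
        obtain ⟨n, m, f, rfl⟩ := T.exists_el f
        obtain ⟨m₁, k, g, rfl⟩ := T.exists_el g
        obtain ⟨n', m', f', rfl⟩ := T.exists_el f'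
        obtain ⟨m₁', k', g', rfl⟩ := T.exists_el g'
        obtain rfl : m = m₁ := ob_inj h
        obtain rfl : m' = m₁' := ob_inj h'
        exact congrArg (arr (T := T)) (T.tensor_comp f g f' g').symm }
    (fun _ => rfl) (fun _ => rfl)

/-- The monad in `Span(Mon)` on `(ℕ, +, 0)` given by the arrows of `T` under the monoidal product,
with identities as unit and composition as multiplication. -/
instance : MonObj T.span where
  one := T.unitCell
  mul := T.multCell
  one_mul := cell_ext fun p => by
    obtain ⟨x, f, h, rfl⟩ := exists_pair p
    obtain ⟨n, m, f, rfl⟩ := T.exists_el f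
    obtain rfl : x = ob n := h
    exact congrArg (arr (T := T)) (T.id_comp f)
  mul_one := cell_ext fun p => by
    obtain ⟨f, x, h, rfl⟩ := exists_pair p
    obtain ⟨n, m, f, rfl⟩ := T.exists_el f
    obtain rfl : ob m = x := h
    exact congrArg (arr (T := T)) (T.comp_id f)
  mul_assoc := cell_ext fun p => by
    obtain ⟨q, k, h, rfl⟩ := exists_pair p
    obtain ⟨f, g, h', rfl⟩ := exists_pair q
    obtain ⟨n, m, f, rfl⟩ := T.exists_el f
    obtain ⟨m₁, k₁, g, rfl⟩ := T.exists_el g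
    obtain ⟨k₂, l, k, rfl⟩ := T.exists_el k
    obtain rfl : m = m₁ := ob_inj h'
    obtain rfl : k₁ = k₂ := ob_inj h
    exact congrArg (arr (T := T)) (T.comp_assoc f g k)

/-- `T` as a monad in `Span(Mon)`, hence as an object of `Mod(Span(Mon))`. -/
def toMnd : Mnd SpanMon.{u} := ⟨natMon, T.span⟩

end PROP

namespace PROP

variable (T : PROP.{u})

/-- The opposite PROP. -/
def op : PROP.{u} where
  Hom n m := T.Hom m n
  id n := T.id n
  comp f g := T.comp g f
  id_comp f := T.comp_id f
  comp_id f := T.id_comp f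
  comp_assoc f g h := (T.comp_assoc h g f).symm
  tensor f g := T.tensor f g
  tensor_id := T.tensor_id
  tensor_comp f g f' g' := T.tensor_comp g f g' f'
  tensor_assoc := T.tensor_assoc
  id_zero_tensor := T.id_zero_tensor
  tensor_id_zero := T.tensor_id_zero
  symm n m := T.symm m n
  symm_naturality f g := (T.symm_naturality g f).symm
  symm_symm n m := T.symm_symm n m
  symm_add n m k a b ha hb := T.add_symm m k n b a hb ha
  add_symm n m k a b ha hb := T.symm_add k n m b a hb ha

/-- The isomorphisms of `T`. -/
@[ext]
structure Iso (n m : ℕ) where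
  hom : T.Hom n m
  inv : T.Hom m n
  hom_inv : T.comp hom inv = T.id n
  inv_hom : T.comp inv hom = T.id m

namespace Iso

variable {T}

theorem ext_hom {n m : ℕ} {f g : T.Iso n m} (h : f.hom = g.hom) : f = g := by
  refine Iso.ext h ?_
  rw [← T.comp_id f.inv, ← g.hom_inv, ← T.comp_assoc, ← h, f.inv_hom, T.id_comp]

theorem heq_of_hom {n m n' m' : ℕ} (hn : n = n') (hm : m = m') {f : T.Iso n m} {g : T.Iso n' m'}
    (h : HEq f.hom g.hom) : HEq f g := by
  subst hn hm
  exact heq_of_eq (ext_hom (eq_of_heq h))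

theorem hom_heq {n m n' m' : ℕ} (hn : n = n') (hm : m = m') {f : T.Iso n m} {g : T.Iso n' m'}
    (h : HEq f g) : HEq f.hom g.hom := by
  subst hn hm
  rw [eq_of_heq h]

end Iso

/-- The core of `T`: the sub-PROP of isomorphisms. -/
def core : PROP.{u} where
  Hom n m := T.Iso n m
  id n := ⟨T.id n, T.id n, T.id_comp _, T.id_comp _⟩
  comp f g :=
    { hom := T.comp f.hom g.hom
      inv := T.comp g.inv f.inv
      hom_inv := by
        rw [T.comp_assoc, ← T.comp_assoc g.hom, g.hom_inv, T.id_comp, f.hom_inv]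
      inv_hom := by
        rw [T.comp_assoc, ← T.comp_assoc f.inv, f.inv_hom, T.id_comp, g.inv_hom] }
  id_comp f := Iso.ext_hom (T.id_comp f.hom)
  comp_id f := Iso.ext_hom (T.comp_id f.hom)
  comp_assoc f g h := Iso.ext_hom (T.comp_assoc f.hom g.hom h.hom)
  tensor f g :=
    { hom := T.tensor f.hom g.hom
      inv := T.tensor f.inv g.inv
      hom_inv := by rw [← T.tensor_comp, f.hom_inv, g.hom_inv, T.tensor_id]
      inv_hom := by rw [← T.tensor_comp, f.inv_hom, g.inv_hom, T.tensor_id] }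
  tensor_id n m := Iso.ext_hom (T.tensor_id n m)
  tensor_comp f g f' g' := Iso.ext_hom (T.tensor_comp f.hom g.hom f'.hom g'.hom)
  tensor_assoc f g h := Iso.heq_of_hom (add_assoc _ _ _) (add_assoc _ _ _)
    (T.tensor_assoc f.hom g.hom h.hom)
  id_zero_tensor f := Iso.heq_of_hom (zero_add _) (zero_add _) (T.id_zero_tensor f.hom)
  tensor_id_zero f := Iso.heq_of_hom (add_zero _) (add_zero _) (T.tensor_id_zero f.hom)
  symm n m := ⟨T.symm n m, T.symm m n, T.symm_symm n m, T.symm_symm m n⟩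
  symm_naturality f g := Iso.ext_hom (T.symm_naturality f.hom g.hom)
  symm_symm n m := Iso.ext_hom (T.symm_symm n m)
  symm_add n m k a b ha hb := Iso.heq_of_hom (add_assoc _ _ _).symm rfl
    (T.symm_add n m k a.hom b.hom (Iso.hom_heq rfl rfl ha)
      (Iso.hom_heq (add_assoc _ _ _) (add_assoc _ _ _) hb))
  add_symm n m k a b ha hb := Iso.heq_of_hom rfl (add_assoc _ _ _).symm
    (T.add_symm n m k a.hom b.hom (Iso.hom_heq (add_assoc _ _ _) (add_assoc _ _ _) ha)
      (Iso.hom_heq rfl rfl hb))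

end PROP

/-- A 1-cell of `Span(Mon)` with a bimodule structure, as a 1-cell of `Mod(Span(Mon))`. -/
abbrev bimod {F G : Mnd SpanMon.{u}} {H : F.x ⟶ G.x} (S : BimodStr F G H) : F ⟶ G :=
  Bimodule.mk H S

section MonadsInMod

variable {J : Mnd SpanMon.{u}} {H : J.x ⟶ J.x} (S : BimodStr J J H)

/-- The unit of a monad on `J` in `Mod(Span(Mon))`, on elements: it goes from the identity 1-cell,
which is `J` as a bimodule over itself. -/
def unitFun (M : MonObj (bimod S)) : Ap J.t →* Ap H :=
  ev (Bimodule.Hom.hom (M := Bimodule.regular J) (N := bimod S) M.one)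

/-- The class `[a, b]` of a composable pair in the tensor product over `J` of the bimodule `H` with
itself. -/
def tclass (a b : Ap H) (h : tgt H a = src H b) :
    Ap (Bimodule.tensorSpan (bimod S) (bimod S)) :=
  Bimodule.tmk (bimod S) (bimod S) a b h

/-- The multiplication of a monad on `J` in `Mod(Span(Mon))`, on elements: it goes from the tensor
product over `J` of the underlying bimodule with itself. -/
def multFun (M : MonObj (bimod S)) :
    Ap (Bimodule.tensorSpan (bimod S) (bimod S)) →* Ap H :=
  ev (Bimodule.Hom.hom (M := Bimodule.tensor (bimod S) (bimod S)) (N := bimod S) M.mul)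

end MonadsInMod

end PropMonad

open PropMonad

namespace PropMonad

namespace PROP

/-! Both halves are instances of one fact, the analogue of "a ring homomorphism `R → S` makes `S` a
monoid in `R`-`R`-bimodules". Let `φ : J → T` be a strict monoidal functor of PROPs that is the
identity on objects. Restricting scalars along `φ` turns the arrows of `T` into a `J`-`J`-bimodule,
with actions `φ a; f` and `f; φ b` (`Fun.bimodStr`). The functor itself becomes a bimodule map out
of the regular bimodule (`Fun.unitHom`). Composition in `T` is balanced over `J`, since `(f; φ a); g
= f; (φ a; g)`, so it descends to the coequaliser `T ⊗_J T` (`Fun.multHom`). The monad laws of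
`Fun.monObj` are then the laws of `T` read on representatives.

Exactly three properties of `φ` enter: preservation of `⊕` makes it a homomorphism of monoids of
arrows, hence a 2-cell of spans, while preservation of identities and of composition gives the unit
and multiplicativity laws of the actions. The spans and their 2-cells do not see the symmetry, so
`Fun` records nothing about it.

The lemma follows from two functors out of the core: the inclusion into `T`, and inversion `j ↦ j⁻¹`
into the opposite. Inversion reverses composition, and passing to `T.op` reverses it once more, so
inversion is covariant as a map to `T.op`; it keeps the order of `⊕`, as does `T.op`. -/

/-- Strict monoidal functors between PROPs that are the identity on objects. -/
structure Fun (J T : PROP.{u}) where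
  map {n m : ℕ} : J.Hom n m → T.Hom n m
  map_id (n : ℕ) : map (J.id n) = T.id n
  map_comp {n m k : ℕ} (f : J.Hom n m) (g : J.Hom m k) :
    map (J.comp f g) = T.comp (map f) (map g)
  map_tensor {n m n' m' : ℕ} (f : J.Hom n m) (g : J.Hom n' m') :
    map (J.tensor f g) = T.tensor (map f) (map g)

/-! ### Restriction of scalars along a functor of PROPs. -/

namespace Fun

variable {J T : PROP.{u}} (φ : Fun J T)

/-- The 2-cell between the spans of arrows given by a functor. -/
def cell : J.span ⟶ T.span :=
  mkCell (S := J.span) (T := T.span)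
    { toFun := fun f : J.Arr => (arr (φ.map f.hom) : T.Arr)
      -- The neutral element for `⊕` is the identity arrow of the object 0, so this is preservation
      -- of that one identity.
      map_one' := congrArg (arr (T := T)) (φ.map_id 0)
      map_mul' := fun f g : J.Arr => congrArg (arr (T := T)) (φ.map_tensor f.hom g.hom) }
    (fun _ => rfl) (fun _ => rfl)

/-- The bimodule structure on the arrows of the codomain of a functor, with actions by composition
along the functor. -/
def bimodStr : BimodStr J.toMnd J.toMnd T.span where
  -- Both actions are composites of existing 2-cells, so compatibility with `⊕` (the interchange
  -- law, already inside `multCell`) and with source and target needs no further proof. Only the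
  -- bimodule axioms remain.
  lact := φ.cell ▷ T.span ≫ T.multCell
  ract := T.span ◁ φ.cell ≫ T.multCell
  unit_lact := cell_ext fun p => by
    obtain ⟨x, f, h, rfl⟩ := exists_pair p
    obtain ⟨n, m, f, rfl⟩ := T.exists_el f
    -- An element of the identity span is an object, and the pullback condition says that it is the
    -- source of `f`.
    obtain rfl : x = ob n := h
    exact congrArg (arr (T := T))
      ((congrArg (fun i => T.comp i f) (φ.map_id n)).trans (T.id_comp f))
  mult_lact := cell_ext fun p => by
    obtain ⟨q, f, h, rfl⟩ := exists_pair p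
    obtain ⟨a, b, h', rfl⟩ := exists_pair q
    obtain ⟨n, m, a, rfl⟩ := J.exists_el a
    obtain ⟨m₁, k, b, rfl⟩ := J.exists_el b
    obtain ⟨k₁, l, f, rfl⟩ := T.exists_el f
    -- Membership in the pullback equates the middle objects only as elements of `natMon`. Once they
    -- are identified as natural numbers, the cast inside `compArr` is along a reflexive equality
    -- and disappears, so the goal becomes an equation between arrows of `T`. The same substitution
    -- recurs in the checks below.
    obtain rfl : m = m₁ := ob_inj h'
    obtain rfl : k = k₁ := ob_inj h
    exact congrArg (arr (T := T))
      ((congrArg (fun i => T.comp i f) (φ.map_comp a b)).trans (T.comp_assoc _ _ f))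
  unit_ract := cell_ext fun p => by
    obtain ⟨f, x, h, rfl⟩ := exists_pair p
    obtain ⟨n, m, f, rfl⟩ := T.exists_el f
    obtain rfl : ob m = x := h
    exact congrArg (arr (T := T)) ((congrArg (T.comp f) (φ.map_id m)).trans (T.comp_id f))
  mult_ract := cell_ext fun p => by
    obtain ⟨f, q, h, rfl⟩ := exists_pair p
    obtain ⟨a, b, h', rfl⟩ := exists_pair q
    obtain ⟨n, m, f, rfl⟩ := T.exists_el f
    obtain ⟨m₁, k, a, rfl⟩ := J.exists_el a
    obtain ⟨k₁, l, b, rfl⟩ := J.exists_el b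
    obtain rfl : m = m₁ := ob_inj h
    obtain rfl : k = k₁ := ob_inj h'
    exact congrArg (arr (T := T))
      ((congrArg (T.comp f) (φ.map_comp a b)).trans (T.comp_assoc f _ _).symm)
  middle := cell_ext fun p => by
    obtain ⟨q, b, h, rfl⟩ := exists_pair p
    obtain ⟨a, f, h', rfl⟩ := exists_pair q
    obtain ⟨n, m, a, rfl⟩ := J.exists_el a
    obtain ⟨m₁, k, f, rfl⟩ := T.exists_el f
    obtain ⟨k₁, l, b, rfl⟩ := J.exists_el b
    obtain rfl : m = m₁ := ob_inj h'
    obtain rfl : k = k₁ := ob_inj h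
    -- The two actions commute by associativity alone: `(φ a; f); φ b = φ a; (f; φ b)`.
    exact congrArg (arr (T := T)) (T.comp_assoc _ f _)

/-! ### The monad on the domain: unit, multiplication and laws. -/

/-- The arrows of the codomain of a functor, as a bimodule over its domain. -/
abbrev bim : Bimodule J.toMnd J.toMnd := ⟨T.span, φ.bimodStr⟩

/-- A functor as a morphism of bimodules over its domain. -/
def unitHom : Bimodule.regular J.toMnd ⟶ φ.bim :=
  Bimodule.Hom.mk (M := Bimodule.regular J.toMnd) (N := φ.bim) φ.cell
    -- Left and right linearity are the same equation `φ (a; b) = φ a; φ b`, because `J` acts on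
    -- itself by composition on either side.
    (cell_ext fun p => by
      obtain ⟨a, b, h, rfl⟩ := exists_pair p
      obtain ⟨n, m, a, rfl⟩ := J.exists_el a
      obtain ⟨m₁, k, b, rfl⟩ := J.exists_el b
      obtain rfl : m = m₁ := ob_inj h
      exact congrArg (arr (T := T)) (φ.map_comp a b))
    (cell_ext fun p => by
      obtain ⟨a, b, h, rfl⟩ := exists_pair p
      obtain ⟨n, m, a, rfl⟩ := J.exists_el a
      obtain ⟨m₁, k, b, rfl⟩ := J.exists_el b
      obtain rfl : m = m₁ := ob_inj h
      exact congrArg (arr (T := T)) (φ.map_comp a b))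

/-- Composition, as a morphism of bimodules from the tensor product: `[f, g] ↦ f; g`. -/
def multHom : Bimodule.tensor φ.bim φ.bim ⟶ φ.bim :=
  Bimodule.Hom.mk (M := Bimodule.tensor φ.bim φ.bim) (N := φ.bim)
    -- Well-definedness on the quotient: the pairs `(f; φ a, g)` and `(f, φ a; g)` have the same
    -- composite.
    (Bimodule.tdesc φ.bim φ.bim T.multCell (cell_ext fun p => by
      obtain ⟨q, g, h, rfl⟩ := exists_pair p
      obtain ⟨f, a, h', rfl⟩ := exists_pair q
      obtain ⟨n, m, f, rfl⟩ := T.exists_el f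
      obtain ⟨m₁, k, a, rfl⟩ := J.exists_el a
      obtain ⟨k₁, l, g, rfl⟩ := T.exists_el g
      obtain rfl : m = m₁ := ob_inj h'
      obtain rfl : k = k₁ := ob_inj h
      exact congrArg (arr (T := T)) (T.comp_assoc f _ g)))
    (cell_ext fun p => by
      obtain ⟨a, q, h, rfl⟩ := exists_pair p
      obtain ⟨f, g, h', rfl⟩ := Bimodule.exists_tmk φ.bim φ.bim q
      obtain ⟨n, m, a, rfl⟩ := J.exists_el a
      obtain ⟨m₁, k, f, rfl⟩ := T.exists_el f
      obtain ⟨k₁, l, g, rfl⟩ := T.exists_el g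
      obtain rfl : m = m₁ := ob_inj h
      obtain rfl : k = k₁ := ob_inj h'
      exact congrArg (arr (T := T)) (T.comp_assoc _ f g))
    (cell_ext fun p => by
      obtain ⟨q, a, h, rfl⟩ := exists_pair p
      obtain ⟨f, g, h', rfl⟩ := Bimodule.exists_tmk φ.bim φ.bim q
      obtain ⟨n, m, f, rfl⟩ := T.exists_el f
      obtain ⟨m₁, k, g, rfl⟩ := T.exists_el g
      obtain ⟨k₁, l, a, rfl⟩ := J.exists_el a
      obtain rfl : m = m₁ := ob_inj h'
      obtain rfl : k = k₁ := ob_inj h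
      exact congrArg (arr (T := T)) (T.comp_assoc f g (φ.map a)).symm)

/-- The codomain of a functor is a monad on its domain in `Mod(Span(Mon))`. -/
@[reducible] def monObj : MonObj (bimod φ.bimodStr) where
  one := φ.unitHom
  mul := φ.multHom
  one_mul := Bimodule.hom_ext fun q => by
    obtain ⟨a, f, h, rfl⟩ := Bimodule.exists_tmk (Bimodule.regular J.toMnd) φ.bim q
    -- Both sides send `[a, f]` to `φ a; f`: the left unitor of the tensor product is the action,
    -- and the action was defined as `φ` followed by composition. The right unit law is symmetric.
    rfl
  mul_one := Bimodule.hom_ext fun q => by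
    obtain ⟨f, a, h, rfl⟩ := Bimodule.exists_tmk φ.bim (Bimodule.regular J.toMnd) q
    rfl
  mul_assoc := Bimodule.hom_ext fun q => by
    -- Every element of the triple tensor product is a class `[[f, g], k]`, which the associator
    -- sends to `[f, [g, k]]`. On such a class the law is associativity in `T`.
    obtain ⟨r, k, h, rfl⟩ := Bimodule.exists_tmk (Bimodule.tensor φ.bim φ.bim) φ.bim q
    obtain ⟨f, g, h', rfl⟩ := Bimodule.exists_tmk φ.bim φ.bim r
    obtain ⟨n, m, f, rfl⟩ := T.exists_el f
    obtain ⟨m₁, k₁, g, rfl⟩ := T.exists_el g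
    obtain ⟨k₂, l, k, rfl⟩ := T.exists_el k
    obtain rfl : m = m₁ := ob_inj h'
    obtain rfl : k₁ = k₂ := ob_inj h
    exact congrArg (arr (T := T)) (T.comp_assoc f g k)

end Fun

/-! ### The two functors out of the core. -/

variable (T : PROP.{u})

/-- The inclusion of the core. -/
def coreIncl : Fun T.core T where
  map j := Iso.hom (T := T) j
  map_id _ := rfl
  map_comp _ _ := rfl
  map_tensor _ _ := rfl

/-- The functor from the core to the opposite PROP that inverts isomorphisms. -/
def coreInv : Fun T.core T.op where
  map j := Iso.inv (T := T) j
  map_id _ := rfl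
  -- In the core the inverse of `f; g` is by construction `g⁻¹; f⁻¹` in `T`, which is literally the
  -- composite of `f⁻¹` and `g⁻¹` in `T.op`.
  map_comp _ _ := rfl
  map_tensor _ _ := rfl

end PROP

end PropMonad

theorem mainTheorem3 (T : PROP.{u}) :
    (∃ S : BimodStr T.core.toMnd T.core.toMnd T.span,
      (∀ (n m k : ℕ) (j : T.Iso n m) (f : T.Hom m k),
        ev S.lact (pair T.core.span T.span (PROP.el (T := T.core) j) (PROP.el f) rfl) =
          PROP.el (T.comp j.hom f)) ∧
      (∀ (n m k : ℕ) (f : T.Hom n m) (j : T.Iso m k),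
        ev S.ract (pair T.span T.core.span (PROP.el f) (PROP.el (T := T.core) j) rfl) =
          PROP.el (T.comp f j.hom)) ∧
      ∃ M : MonObj (bimod S),
        (∀ (n m : ℕ) (j : T.Iso n m), unitFun S M (PROP.el (T := T.core) j) = PROP.el j.hom) ∧
        (∀ (n m k : ℕ) (f : T.Hom n m) (g : T.Hom m k),
          multFun S M (tclass S (PROP.el f) (PROP.el g) rfl) =
            PROP.el (T.comp f g))) ∧
    (∃ S : BimodStr T.core.toMnd T.core.toMnd T.op.span,
      (∀ (n m k : ℕ) (j : T.Iso n m) (f : T.op.Hom m k),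
        ev S.lact (pair T.core.span T.op.span (PROP.el (T := T.core) j) (PROP.el f) rfl) =
          PROP.el (T.op.comp j.inv f)) ∧
      (∀ (n m k : ℕ) (f : T.op.Hom n m) (j : T.Iso m k),
        ev S.ract (pair T.op.span T.core.span (PROP.el f) (PROP.el (T := T.core) j) rfl) =
          PROP.el (T.op.comp f j.inv)) ∧
      ∃ M : MonObj (bimod S),
        (∀ (n m : ℕ) (j : T.Iso n m),
          unitFun S M (PROP.el (T := T.core) j) = PROP.el (T := T.op) j.inv) ∧
        (∀ (n m k : ℕ) (f : T.op.Hom n m) (g : T.op.Hom m k),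
          multFun S M (tclass S (PROP.el (T := T.op) f) (PROP.el (T := T.op) g) rfl) =
            PROP.el (T := T.op) (T.op.comp f g))) := by
  -- The formulas on elements hold by computation: the middle objects agree syntactically, so the
  -- cast in `compArr` reduces, and a map out of the quotient evaluates on a class `[f, g]` by its
  -- value at the representative.
  exact ⟨⟨T.coreIncl.bimodStr, fun _ _ _ _ _ => rfl, fun _ _ _ _ _ => rfl, T.coreIncl.monObj,
      fun _ _ _ => rfl, fun _ _ _ _ _ => rfl⟩,
    ⟨T.coreInv.bimodStr, fun _ _ _ _ _ => rfl, fun _ _ _ _ _ => rfl, T.coreInv.monObj,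
      fun _ _ _ => rfl, fun _ _ _ _ _ => rfl⟩⟩
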